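/- Let $B$ be a finite-dimensional register and, for $b\in\{0,1\}$, let $\{p^b_i,|\alpha^b_i\rangle\}_{i\in I_b}$ be a finite mixture of pure states of $B$ realizing the density matrix $\rho_b=\sum_i p^b_i|\alpha^b_i\rangle\langle\alpha^b_i|$. Consider the bit-encoding protocol in which honest Alice encodes $b$ by sending Bob $|\alpha^b_i\rangle$ with probability $p^b_i$, later reveals $(b,i)$, and Bob checks by projecting his register onto $|\alpha^b_i\rangle$, declaring $err$ if the projection fails. A (cheating) strategy of Alice consists of a pure state of $A\otimes B$, where $A$ is any finite-dimensional register that she keeps while $B$ is sent to Bob, and of two measurements of $A$ with outcomes $(b,i)$, one used at revealing time in her zero strategy and one in her one strategy; she sends the outcome to Bob. Let $p_0,p_1,p_{err}$ be the probabilities that she sends $b=0$, that she sends $b=1$, and that Bob declares $err$ in the zero strategy, and $q_0,q_1,q_{err}$ the same for the one strategy. The protocol is $(\epsilon,\gamma)$ binding if, for every strategy of Alice, $p_{err},q_{err}\le\epsilon$ implies $|p_0-q_0|,|p_1-q_1|\le\gamma$. Let $f=f(\rho_0,\rho_1)=\sup|\langle\phi_0|\phi_1\rangle|^2$ be the fidelity,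 the supremum being over all purifications $\phi_0$ of $\rho_0$ and $\phi_1$ of $\rho_1$ in a common space. For every $0\le\alpha\le\pi/4$ Alice has a strategy with advantage $$p_0-q_0=q_1-p_1=\frac{\sqrt f\,\sin(2\alpha)}{2}$$ and detection probability at most $\frac{(1-f)\sin^2\alpha}{2}$, that is, $p_{err},q_{err}\le\frac{(1-f)\sin^2\alpha}{2}$. Consequently, the protocol is not $\left(\frac{(1-f)\sin^2\alpha}{2},\gamma\right)$ binding for any $\gamma<\frac{\sqrt f\,\sin(2\alpha)}{2}$. -/

import Mathlib

open scoped Kronecker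

noncomputable section

namespace BitEscrow

/-- The vectors of the Hilbert space `ℂ^S`, with its Euclidean norm and inner product.
A pure state of a register with computational basis `S` is a vector of norm `1`;
the joint space of registers `A` and `B` is `Vec (A × B)`. -/
abbrev Vec (S : Type) : Type := EuclideanSpace ℂ S

/-- The density matrix `|φ⟩⟨φ|`. -/
def ketBra {S : Type} (φ : Vec S) : Matrix S S ℂ :=
  Matrix.of fun i j => φ i * star (φ j)

/-- The density matrix on `B` of a pure state of `A ⊗ B`, the register `A` being traced out. -/
def reduced {A B : Type} [Fintype A] (φ : Vec (A × B)) : Matrix B B ℂ :=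
  Matrix.of fun b b' => ∑ a, ketBra φ (a, b) (a, b')

/-- `φ`, a pure state of `A ⊗ B`, is a purification of the density matrix `ρ` on `B`. -/
def IsPurification {A B : Type} [Fintype A] [Fintype B]
    (φ : Vec (A × B)) (ρ : Matrix B B ℂ) : Prop :=
  ‖φ‖ = 1 ∧ reduced φ = ρ

/-- The fidelity of two density matrices: the supremum of `|⟨φ₀|φ₁⟩|²` over all purifications
of both in a common (finite-dimensional) space `A ⊗ B`. -/
def fidelity {B : Type} [Fintype B] (ρ₀ ρ₁ : Matrix B B ℂ) : ℝ :=
  sSup {r : ℝ | ∃ (n : ℕ) (φ₀ φ₁ : Vec (Fin n × B)),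
    IsPurification φ₀ ρ₀ ∧ IsPurification φ₁ ρ₁ ∧ r = ‖inner ℂ φ₀ φ₁‖ ^ 2}

/-- A finite mixture `{pᵢ, |αᵢ⟩}` of pure states of the register `B`. -/
structure Mixture (B I : Type) [Fintype B] [Fintype I] where
  prob : I → ℝ
  state : I → Vec B
  prob_nonneg : ∀ i, 0 ≤ prob i
  prob_sum : ∑ i, prob i = 1
  state_norm : ∀ i, ‖state i‖ = 1

/-- The density matrix `∑ᵢ pᵢ |αᵢ⟩⟨αᵢ|` that a mixture realizes. -/
def Mixture.density {B I : Type} [Fintype B] [Fintype I] (M : Mixture B I) : Matrix B B ℂ :=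
  ∑ i, (M.prob i : ℂ) • ketBra (M.state i)

/-- An orthogonal measurement of the register `A` with outcomes in `K`: the orthogonal
projections onto pairwise orthogonal subspaces whose sum is the whole space. -/
structure Measurement (A K : Type) [Fintype A] [DecidableEq A] [Fintype K] where
  proj : K → Matrix A A ℂ
  hermitian : ∀ k, (proj k).IsHermitian
  idempotent : ∀ k, proj k * proj k = proj k
  orthogonal : ∀ k l, k ≠ l → proj k * proj l = 0
  complete : ∑ k, proj k = 1

/-- What Alice sends at revealing time: a bit `b` and an index `i` of the `b`-th mixture. -/
abbrev Claim (I : Fin 2 → Type) : Type := (b : Fin 2) × I b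

/-- A strategy of Alice. She prepares a pure state of `A ⊗ B` and sends the register `B`. At
revealing time she measures `A` and sends the outcome, a claim; the measurement is `reveal 0`
in her zero strategy and `reveal 1` in her one strategy. Ancillas and unitary transformations
used by Alice are part of `A` and of the measurements. -/
structure Strategy (A B : Type) (I : Fin 2 → Type) [Fintype A] [DecidableEq A] [Fintype B]
    [∀ b, Fintype (I b)] where
  deposit : Vec (A × B)
  deposit_norm : ‖deposit‖ = 1
  reveal : Fin 2 → Measurement A (Claim I)

section

variable {A B : Type} {I : Fin 2 → Type} [Fintype A] [DecidableEq A] [Fintype B] [DecidableEq B]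
  [∀ b, Fintype (I b)]

/-- The probability that Alice sends the bit `b` in her strategy number `t`:
her outcome `(b, i)` has probability `‖(P_{b,i} ⊗ 1) ψ‖²`. -/
def Strategy.claimProb (S : Strategy A B I) (t b : Fin 2) : ℝ :=
  ∑ i : I b,
    ‖Matrix.toLpLin 2 2 ((S.reveal t).proj ⟨b, i⟩ ⊗ₖ (1 : Matrix B B ℂ)) S.deposit‖ ^ 2

/-- The probability that Bob, who projects his register on the claimed state `|α^b_i⟩`, finds
that Alice is cheating (`r_B = err`) in her strategy number `t`: the outcome `(b, i)` of Alice
followed by the orthogonal complement of `|α^b_i⟩` for Bob has probability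
`‖(P_{b,i} ⊗ (1 - |α^b_i⟩⟨α^b_i|)) ψ‖²`. -/
def Strategy.errProb (S : Strategy A B I) (M : ∀ b, Mixture B (I b)) (t : Fin 2) : ℝ :=
  ∑ k : Claim I,
    ‖Matrix.toLpLin 2 2
      ((S.reveal t).proj k ⊗ₖ (1 - ketBra ((M k.1).state k.2))) S.deposit‖ ^ 2

end

/-- The protocol given by the mixtures `M 0`, `M 1` is `(ε, γ)` binding: whenever a strategy
of Alice is detected with probability at most `ε` both in its zero and in its one strategy,
the probabilities of claiming each bit in these two differ by at most `γ`. -/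
def IsBinding {B : Type} {I : Fin 2 → Type} [Fintype B] [DecidableEq B]
    [∀ b, Fintype (I b)] (M : ∀ b, Mixture B (I b)) (ε γ : ℝ) : Prop :=
  ∀ (A : Type) [Fintype A] [DecidableEq A] (S : Strategy A B I),
    S.errProb M 0 ≤ ε → S.errProb M 1 ≤ ε →
      |S.claimProb 0 0 - S.claimProb 1 0| ≤ γ ∧ |S.claimProb 0 1 - S.claimProb 1 1| ≤ γ

end BitEscrow

end

/-! Each mixture has a canonical purification `χ_b = ∑ √pᵢ |i⟩|αᵢ⟩`, and every purification of the
same density matrix is `(K ⊗ 1)χ_b` for a contraction `K` (`exists_contraction_of_reduced_eq`).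
Overlaps of purifications are thus values of one linear functional at contractions `K₀ᴴK₁`. By
compactness some contraction gives exactly `√f`, and dilating it to `V₀ᴴV₁` yields unit vectors `φ_b
= (V_b ⊗ 1)χ_b` with `⟨φ₀|φ₁⟩ = √f` (`exists_isometries_inner_eq_sqrt_fidelity`). As `V_b` is an
isometry, Alice can still open `φ_b` with no risk of detection (`Mixture.exists_opening`).

Alice deposits `(|0⟩φ₀ + |1⟩φ₁)/√2` and measures the control qubit in a basis rotated by an angle
`±β/2`. With `c, s` the cosine and sine of `β/2`, interference moves the claim probabilities to `(1
± 2cs√f)/2`, while the state left differs from a multiple of the claimed `φ_b` only by a component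
of order `s` (`controlled_probabilities`). Taking `sin β = sin(2α)/2` gives the advantage exactly,
and `s² ≤ sin²α/2` bounds detection. -/

noncomputable section

namespace BitEscrow

open Matrix

/-! ### Contractions, projections and dilations -/

section Analysis

/-- If `X` and `Y` have the same Gram operator, then `Y` factors through `X` by a contraction. -/
theorem exists_contraction_comp_eq {E F G : Type*} [NormedAddCommGroup E] [InnerProductSpace ℂ E]
    [NormedAddCommGroup F] [InnerProductSpace ℂ F] [FiniteDimensional ℂ F]
    [NormedAddCommGroup G] [InnerProductSpace ℂ G]
    (X : E →ₗ[ℂ] F) (Y : E →ₗ[ℂ] G) (h : ∀ v, ‖X v‖ = ‖Y v‖) :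
    ∃ K : F →ₗ[ℂ] G, (∀ w, ‖K w‖ ≤ ‖w‖) ∧ K ∘ₗ X = Y := by
  obtain ⟨g, hg⟩ := X.rangeRestrict.exists_rightInverse_of_surjective X.range_rangeRestrict
  have hXg (w : X.range) : X (g w) = w := congrArg Subtype.val (LinearMap.congr_fun hg w)
  refine ⟨Y ∘ₗ g ∘ₗ (X.range.orthogonalProjectionOnto : F →ₗ[ℂ] X.range), fun w => ?_, ?_⟩
  · calc ‖Y (g (X.range.orthogonalProjectionOnto w))‖
        = ‖X.range.orthogonalProjectionOnto w‖ := by rw [← h, hXg]; rfl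
      _ ≤ ‖w‖ := X.range.norm_orthogonalProjectionOnto_apply_le w
  · ext v
    have hv : X.range.orthogonalProjectionOnto (X v) = X.rangeRestrict v :=
      X.range.orthogonalProjectionOnto_mem_subspace_eq_self (X.rangeRestrict v)
    -- `X` kills this difference, hence so does `Y`, the norms being equal.
    have h0 : ‖Y (g (X.rangeRestrict v) - v)‖ = 0 := by
      rw [← h, map_sub, hXg]; simp
    have := norm_eq_zero.1 h0
    rw [map_sub, sub_eq_zero] at this
    simpa [hv] using this

set_option linter.unusedSectionVars false

variable {S T U : Type*} [Fintype S] [DecidableEq S] [Fintype T] [DecidableEq T]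
  [Fintype U] [DecidableEq U]

theorem inner_toLpLin_left (A : Matrix S T ℂ) (v : EuclideanSpace ℂ T) (w : EuclideanSpace ℂ S) :
    inner ℂ (toLpLin 2 2 A v) w = inner ℂ v (toLpLin 2 2 Aᴴ w) := by
  have := toEuclideanLin_conjTranspose_eq_adjoint A
  change toLpLin 2 2 Aᴴ = _ at this
  rw [this, LinearMap.adjoint_inner_right]

theorem toLpLin_mul_apply (A : Matrix S T ℂ) (B : Matrix T U ℂ) (v : EuclideanSpace ℂ U) :
    toLpLin 2 2 (A * B) v = toLpLin 2 2 A (toLpLin 2 2 B v) := by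
  rw [toLpLin_mul_same]; rfl

theorem norm_toLpLin_of_isometry {V : Matrix S T ℂ} (hV : Vᴴ * V = 1) (v : EuclideanSpace ℂ T) :
    ‖toLpLin 2 2 V v‖ = ‖v‖ := by
  have h : inner ℂ (toLpLin 2 2 V v) (toLpLin 2 2 V v) = inner ℂ v v := by
    rw [inner_toLpLin_left, ← toLpLin_mul_apply, hV]; simp
  rw [inner_self_eq_norm_sq_to_K, inner_self_eq_norm_sq_to_K] at h
  have : ‖toLpLin 2 2 V v‖ ^ 2 = ‖v‖ ^ 2 := by exact_mod_cast h
  exact (pow_left_inj₀ (norm_nonneg _) (norm_nonneg _) two_ne_zero).1 this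

theorem norm_sq_toLpLin_projection {P : Matrix S S ℂ} (hP : P.IsHermitian) (hPP : P * P = P)
    (v : EuclideanSpace ℂ S) :
    ‖toLpLin 2 2 P v‖ ^ 2 = RCLike.re (inner ℂ v (toLpLin 2 2 P v)) := by
  rw [← inner_self_eq_norm_sq (𝕜 := ℂ), inner_toLpLin_left, ← toLpLin_mul_apply, hP.eq, hPP]

theorem norm_toLpLin_projection_le {P : Matrix S S ℂ} (hP : P.IsHermitian) (hPP : P * P = P)
    (v : EuclideanSpace ℂ S) : ‖toLpLin 2 2 P v‖ ≤ ‖v‖ := by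
  have h := norm_sq_toLpLin_projection hP hPP v
  have h' : RCLike.re (inner ℂ v (toLpLin 2 2 P v)) ≤ ‖v‖ * ‖toLpLin 2 2 P v‖ :=
    re_inner_le_norm _ _
  by_contra! hlt
  nlinarith [norm_nonneg v]

theorem sum_norm_sq_toLpLin_projection {K : Type*} [Fintype K] {P : K → Matrix S S ℂ}
    (hP : ∀ k, (P k).IsHermitian) (hPP : ∀ k, P k * P k = P k) (hsum : ∑ k, P k = 1)
    (v : EuclideanSpace ℂ S) : ∑ k, ‖toLpLin 2 2 (P k) v‖ ^ 2 = ‖v‖ ^ 2 := by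
  simp_rw [norm_sq_toLpLin_projection (hP _) (hPP _)]
  rw [← map_sum, ← inner_sum, ← LinearMap.sum_apply, ← map_sum, hsum, toLpLin_one,
    LinearMap.id_apply, inner_self_eq_norm_sq]

section Dilation

open scoped Matrix.Norms.L2Operator MatrixOrder ComplexOrder

theorem norm_toLpLin_le (W : Matrix S T ℂ) (x : EuclideanSpace ℂ T) :
    ‖toLpLin 2 2 W x‖ ≤ ‖W‖ * ‖x‖ :=
  l2_opNorm_mulVec W x

theorem l2_opNorm_le_one {W : Matrix S T ℂ} (h : ∀ x, ‖toLpLin 2 2 W x‖ ≤ ‖x‖) : ‖W‖ ≤ 1 := by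
  rw [l2_opNorm_def]
  exact ContinuousLinearMap.opNorm_le_bound _ zero_le_one fun x => by
    rw [one_mul]; exact h x

theorem posSemidef_one_sub_conjTranspose_mul {W : Matrix S T ℂ} (hW : ‖W‖ ≤ 1) :
    (1 - Wᴴ * W).PosSemidef := by
  have hH : (1 - Wᴴ * W).IsHermitian := isHermitian_one.sub (isHermitian_conjTranspose_mul_self W)
  refine .of_dotProduct_mulVec_nonneg hH fun x => ?_
  set v : EuclideanSpace ℂ T := WithLp.toLp 2 x
  have h1 : star x ⬝ᵥ ((1 - Wᴴ * W) *ᵥ x) = inner ℂ v (toLpLin 2 2 (1 - Wᴴ * W) v) := by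
    rw [EuclideanSpace.inner_eq_star_dotProduct, dotProduct_comm]; rfl
  have h2 : inner ℂ v (toLpLin 2 2 (1 - Wᴴ * W) v)
      = ((‖v‖ ^ 2 - ‖toLpLin 2 2 W v‖ ^ 2 : ℝ) : ℂ) := by
    rw [map_sub, LinearMap.sub_apply, inner_sub_right, toLpLin_mul_apply, ← inner_toLpLin_left,
      toLpLin_one, LinearMap.id_apply, inner_self_eq_norm_sq_to_K, inner_self_eq_norm_sq_to_K]
    push_cast; rfl
  have h3 : ‖toLpLin 2 2 W v‖ ≤ ‖v‖ :=
    (norm_toLpLin_le W v).trans (mul_le_of_le_one_left (norm_nonneg _) hW)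
  rw [h1, h2]
  exact_mod_cast sub_nonneg.2 (pow_le_pow_left₀ (norm_nonneg _) h3 2)

/-- A contraction is the product of two isometries into a common larger space. -/
theorem exists_isometries_of_contraction {W : Matrix S T ℂ} (hW : ‖W‖ ≤ 1) :
    ∃ (V₀ : Matrix (S ⊕ T) S ℂ) (V₁ : Matrix (S ⊕ T) T ℂ),
      V₀ᴴ * V₀ = 1 ∧ V₁ᴴ * V₁ = 1 ∧ V₀ᴴ * V₁ = W := by
  obtain ⟨D, hD⟩ := CStarAlgebra.nonneg_iff_eq_star_mul_self.mp
    (posSemidef_one_sub_conjTranspose_mul hW).nonneg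
  -- `D` is the defect operator, `DᴴD = 1 - WᴴW`: it supplies the norm that `W` loses.
  refine ⟨fromRows 1 0, fromRows W D, ?_, ?_, ?_⟩
  · rw [conjTranspose_fromRows_eq_fromCols_conjTranspose, fromCols_mul_fromRows]; simp
  · rw [conjTranspose_fromRows_eq_fromCols_conjTranspose, fromCols_mul_fromRows,
      ← star_eq_conjTranspose D, ← hD]
    abel
  · rw [conjTranspose_fromRows_eq_fromCols_conjTranspose, fromCols_mul_fromRows]; simp

/-- A linear functional on matrices that exceeds `r` in absolute value at contractions, in the
supremum, takes the value `r` at some contraction. -/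
theorem exists_contraction_apply_eq (L : Matrix S T ℂ →ₗ[ℂ] ℂ) {r : ℝ} (hr : 0 ≤ r)
    (hL : ∀ c, (∀ W : Matrix S T ℂ, ‖W‖ ≤ 1 → ‖L W‖ ≤ c) → r ≤ c) :
    ∃ W : Matrix S T ℂ, ‖W‖ ≤ 1 ∧ L W = r := by
  have : ProperSpace (Matrix S T ℂ) := FiniteDimensional.proper ℂ _
  have hcont : Continuous fun W => ‖L W‖ := L.continuous_of_finiteDimensional.norm
  obtain ⟨W, hW, hmax⟩ := (isCompact_closedBall (0 : Matrix S T ℂ) 1).exists_isMaxOn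
    ⟨0, by simp⟩ hcont.continuousOn
  rw [mem_closedBall_zero_iff] at hW
  have hrW : r ≤ ‖L W‖ := hL _ fun W' hW' => hmax (by simpa using hW')
  rcases eq_or_ne (L W) 0 with h0 | h0
  · refine ⟨0, by simp, ?_⟩
    rw [h0, norm_zero] at hrW
    simp [le_antisymm hrW hr]
  · refine ⟨((r : ℂ) / L W) • W, ?_, by simp [h0]⟩
    rw [norm_smul, norm_div, Complex.norm_of_nonneg hr]
    exact mul_le_one₀ (div_le_one_of_le₀ hrW (norm_nonneg _)) (norm_nonneg _) hW

end Dilation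

end Analysis

/-! ### Purifications and attainment of the fidelity -/

section Purifications

open scoped Matrix.Norms.L2Operator

set_option linter.unusedSectionVars false

variable {A B I J X : Type} [Fintype A] [DecidableEq A] [Fintype B] [DecidableEq B]
  [Fintype I] [DecidableEq I] [Fintype J] [DecidableEq J] [Fintype X] [DecidableEq X]

theorem toLpLin_kronecker_apply (K : Matrix A I ℂ) (N : Matrix B B ℂ) (v : Vec (I × B))
    (a : A) (b : B) :
    toLpLin 2 2 (K ⊗ₖ N) v (a, b) = ∑ i, K a i * ∑ b', N b b' * v (i, b') := by
  simp only [toLpLin_apply, mulVec, dotProduct, Fintype.sum_prod_type, kronecker_apply,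
    Finset.mul_sum, mul_assoc]

theorem toLpLin_kronecker_one_apply (K : Matrix A I ℂ) (v : Vec (I × B)) (a : A) (b : B) :
    toLpLin 2 2 (K ⊗ₖ (1 : Matrix B B ℂ)) v (a, b) = ∑ i, K a i * v (i, b) := by
  simp [toLpLin_kronecker_apply, one_apply]

/-- The coefficient matrix of a vector of `A ⊗ B`. -/
def coeffMatrix (φ : Vec (A × B)) : Matrix A B ℂ := of fun a b => φ (a, b)

theorem conjTranspose_coeffMatrix_mul_self (φ : Vec (A × B)) :
    (coeffMatrix φ)ᴴ * coeffMatrix φ = (reduced φ)ᵀ := by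
  ext b b'
  simp [mul_apply, coeffMatrix, reduced, ketBra, mul_comm]

/-- Two vectors with the same reduced density matrix on `B` are related by a contraction
acting on the other register. -/
theorem exists_contraction_of_reduced_eq (φ : Vec (A × B)) (χ : Vec (I × B))
    (h : reduced φ = reduced χ) :
    ∃ K : Matrix A I ℂ, ‖K‖ ≤ 1 ∧ φ = toLpLin 2 2 (K ⊗ₖ (1 : Matrix B B ℂ)) χ := by
  -- The reduced density matrix is, up to transposition, the Gram matrix of the coefficient matrix.
  have hnorm (v : Vec B) : ‖toLpLin 2 2 (coeffMatrix χ) v‖ = ‖toLpLin 2 2 (coeffMatrix φ) v‖ := by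
    refine (pow_left_inj₀ (norm_nonneg _) (norm_nonneg _) two_ne_zero).1 ?_
    rw [← inner_self_eq_norm_sq (𝕜 := ℂ), ← inner_self_eq_norm_sq (𝕜 := ℂ), inner_toLpLin_left,
      inner_toLpLin_left, ← toLpLin_mul_apply, ← toLpLin_mul_apply,
      conjTranspose_coeffMatrix_mul_self, conjTranspose_coeffMatrix_mul_self, h]
  obtain ⟨K, hK, hKX⟩ := exists_contraction_comp_eq _ _ hnorm
  obtain ⟨K, rfl⟩ := (toLpLin 2 2 : Matrix A I ℂ ≃ₗ[ℂ] _).surjective K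
  refine ⟨K, l2_opNorm_le_one hK, ?_⟩
  rw [← toLpLin_mul_same] at hKX
  have hKX := (toLpLin 2 2).injective hKX
  ext ⟨a, b⟩
  rw [toLpLin_kronecker_one_apply]
  exact (congrFun (congrFun hKX a) b).symm

/-- The purification `∑ᵢ √pᵢ |i⟩|αᵢ⟩` of the density matrix of a mixture. -/
def Mixture.purification (M : Mixture B I) : Vec (I × B) :=
  WithLp.toLp 2 fun x => (√(M.prob x.1) : ℂ) * M.state x.1 x.2

theorem Mixture.reduced_purification (M : Mixture B I) : reduced M.purification = M.density := by
  ext b b'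
  simp only [reduced, ketBra, density, purification, of_apply, Matrix.sum_apply, Matrix.smul_apply, smul_eq_mul]
  refine Finset.sum_congr rfl fun i _ => ?_
  have h : (√(M.prob i) : ℂ) * √(M.prob i) = M.prob i := by
    rw [← Complex.ofReal_mul, Real.mul_self_sqrt (M.prob_nonneg i)]
  rw [star_mul', Complex.star_def, Complex.conj_ofReal, ← h]
  ring

theorem Mixture.norm_purification (M : Mixture B I) : ‖M.purification‖ = 1 := by
  refine (pow_left_inj₀ (norm_nonneg _) zero_le_one two_ne_zero).1 ?_
  rw [EuclideanSpace.norm_sq_eq, Fintype.sum_prod_type, one_pow, ← M.prob_sum]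
  refine Finset.sum_congr rfl fun i _ => ?_
  have h := EuclideanSpace.norm_sq_eq (M.state i)
  rw [M.state_norm, one_pow] at h
  simp only [purification, norm_mul, mul_pow, ← Finset.mul_sum, ← h, mul_one]
  rw [Complex.norm_of_nonneg (Real.sqrt_nonneg _), Real.sq_sqrt (M.prob_nonneg i)]

/-- The linear functional `W ↦ ⟨χ₀|(W ⊗ 1)|χ₁⟩`. -/
def overlap (χ₀ : Vec (I × B)) (χ₁ : Vec (J × B)) : Matrix I J ℂ →ₗ[ℂ] ℂ where
  toFun W := inner ℂ χ₀ (toLpLin 2 2 (W ⊗ₖ (1 : Matrix B B ℂ)) χ₁)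
  map_add' W W' := by rw [add_kronecker, map_add, LinearMap.add_apply, inner_add_right]
  map_smul' c W := by
    rw [smul_kronecker, map_smul, LinearMap.smul_apply, inner_smul_right]; rfl

theorem inner_toLpLin_kronecker_one (K₀ : Matrix A I ℂ) (K₁ : Matrix A J ℂ)
    (χ₀ : Vec (I × B)) (χ₁ : Vec (J × B)) :
    inner ℂ (toLpLin 2 2 (K₀ ⊗ₖ (1 : Matrix B B ℂ)) χ₀)
      (toLpLin 2 2 (K₁ ⊗ₖ (1 : Matrix B B ℂ)) χ₁) = overlap χ₀ χ₁ (K₀ᴴ * K₁) := by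
  rw [inner_toLpLin_left, ← toLpLin_mul_apply, conjTranspose_kronecker, ← mul_kronecker_mul,
    conjTranspose_one, one_mul]
  rfl

theorem fidelity_nonneg (ρ₀ ρ₁ : Matrix B B ℂ) : 0 ≤ fidelity ρ₀ ρ₁ :=
  Real.sSup_nonneg fun _ ⟨_, _, _, _, _, hr⟩ => hr ▸ sq_nonneg _

/-- The fidelity of the density matrices of two mixtures is attained, up to a phase, by
isometric images of their canonical purifications. -/
theorem exists_isometries_inner_eq_sqrt_fidelity (M : Mixture B I) (N : Mixture B J) :
    ∃ (V₀ : Matrix (I ⊕ J) I ℂ) (V₁ : Matrix (I ⊕ J) J ℂ), V₀ᴴ * V₀ = 1 ∧ V₁ᴴ * V₁ = 1 ∧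
      inner ℂ (toLpLin 2 2 (V₀ ⊗ₖ (1 : Matrix B B ℂ)) M.purification)
        (toLpLin 2 2 (V₁ ⊗ₖ (1 : Matrix B B ℂ)) N.purification) =
          ((√(fidelity M.density N.density) : ℝ) : ℂ) := by
  obtain ⟨W, hW, hLW⟩ := exists_contraction_apply_eq (overlap M.purification N.purification)
    (Real.sqrt_nonneg (fidelity M.density N.density)) fun c hc => by
      have hc0 : 0 ≤ c := by simpa using hc 0 (by simp)
      refine Real.sqrt_le_iff.2 ⟨hc0, Real.sSup_le ?_ (sq_nonneg c)⟩
      rintro r ⟨n, φ₀, φ₁, ⟨-, h₀⟩, ⟨-, h₁⟩, rfl⟩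
      obtain ⟨K₀, hK₀, rfl⟩ := exists_contraction_of_reduced_eq φ₀ M.purification
        (h₀.trans M.reduced_purification.symm)
      obtain ⟨K₁, hK₁, rfl⟩ := exists_contraction_of_reduced_eq φ₁ N.purification
        (h₁.trans N.reduced_purification.symm)
      rw [inner_toLpLin_kronecker_one]
      refine pow_le_pow_left₀ (norm_nonneg _) (hc _ ?_) 2
      refine (l2_opNorm_mul _ _).trans (mul_le_one₀ ?_ (norm_nonneg _) hK₁)
      rwa [l2_opNorm_conjTranspose]
  obtain ⟨V₀, V₁, h₀, h₁, rfl⟩ := exists_isometries_of_contraction hW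
  exact ⟨V₀, V₁, h₀, h₁, by rw [inner_toLpLin_kronecker_one, hLW]⟩

end Purifications

/-! ### Undetected openings and the cost of deviating from them -/

section Opening

set_option linter.unusedSectionVars false

variable {B I X : Type} [Fintype B] [DecidableEq B] [Fintype I] [DecidableEq I]
  [Fintype X] [DecidableEq X]

theorem Mixture.nonempty (M : Mixture B I) : Nonempty I := by
  by_contra h
  rw [not_nonempty_iff] at h
  simpa using M.prob_sum

/-- Bob's projection onto the orthogonal complement of the `i`-th state. -/
def Mixture.reject (M : Mixture B I) (i : I) : Matrix B B ℂ := 1 - ketBra (M.state i)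

theorem ketBra_mul_self {φ : Vec B} (hφ : ‖φ‖ = 1) : ketBra φ * ketBra φ = ketBra φ := by
  have h : ∑ j, star (φ j) * φ j = (1 : ℂ) := by
    have h := inner_self_eq_norm_sq_to_K (𝕜 := ℂ) φ
    rw [hφ, EuclideanSpace.inner_eq_star_dotProduct, dotProduct_comm] at h
    simpa [dotProduct] using h
  ext i k
  simp only [mul_apply, ketBra, of_apply]
  calc ∑ j, φ i * star (φ j) * (φ j * star (φ k))
      = φ i * (∑ j, star (φ j) * φ j) * star (φ k) := by
        rw [Finset.mul_sum, Finset.sum_mul]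
        exact Finset.sum_congr rfl fun j _ => by ring
    _ = _ := by rw [h, mul_one]

theorem isHermitian_ketBra (φ : Vec B) : (ketBra φ).IsHermitian := by
  ext i j
  simp [ketBra, mul_comm]

theorem Mixture.isHermitian_reject (M : Mixture B I) (i : I) : (M.reject i).IsHermitian :=
  isHermitian_one.sub (isHermitian_ketBra _)

theorem Mixture.reject_mul_self (M : Mixture B I) (i : I) :
    M.reject i * M.reject i = M.reject i := by
  rw [reject, mul_sub, sub_mul, sub_mul, ketBra_mul_self (M.state_norm i)]
  simp

theorem Mixture.reject_mulVec_state (M : Mixture B I) (i : I) (b : B) :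
    ∑ b', M.reject i b b' * M.state i b' = 0 := by
  have h : ∑ j, star (M.state i j) * M.state i j = (1 : ℂ) := by
    have h := inner_self_eq_norm_sq_to_K (𝕜 := ℂ) (M.state i)
    rw [M.state_norm, EuclideanSpace.inner_eq_star_dotProduct, dotProduct_comm] at h
    simpa [dotProduct] using h
  simp only [reject, Matrix.sub_apply, sub_mul, Finset.sum_sub_distrib, ketBra, of_apply, mul_assoc,
    ← Finset.mul_sum, h]
  simp [one_apply]

/-- An isometric image of the canonical purification of a mixture can be measured so that the
outcome always passes Bob's test. -/
theorem Mixture.exists_opening (M : Mixture B I) {V : Matrix X I ℂ} (hV : Vᴴ * V = 1) :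
    ∃ Q : Measurement X I, ∀ i, toLpLin 2 2 (Q.proj i ⊗ₖ M.reject i)
      (toLpLin 2 2 (V ⊗ₖ (1 : Matrix B B ℂ)) M.purification) = 0 := by
  obtain ⟨i₀⟩ := M.nonempty
  set D : I → Matrix I I ℂ := fun i => Matrix.single i i 1
  -- The measurement is the computational one transported by `V`. The complement of the range of `V`
  -- goes to an arbitrary outcome `i₀` to make it complete; this is harmless because `E i * V = 0`.
  set E : I → Matrix X X ℂ := fun i => if i = i₀ then 1 - V * Vᴴ else 0
  have hDD (i : I) : D i * D i = D i := by simp [D]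
  have hDD' (i j : I) (h : i ≠ j) : D i * D j = 0 := by simp [D, h]
  have hEV (i : I) : E i * V = 0 := by
    by_cases h : i = i₀ <;> simp [E, h, Matrix.sub_mul, Matrix.mul_assoc, hV]
  have hVE (i : I) : Vᴴ * E i = 0 := by
    by_cases h : i = i₀ <;> simp [E, h, Matrix.mul_sub, ← Matrix.mul_assoc, hV]
  have hDH (i : I) : (D i)ᴴ = D i := by simp [D, conjTranspose_single]
  have hEH (i : I) : (E i)ᴴ = E i := by by_cases h : i = i₀ <;> simp [E, h]
  have hEE (i : I) : E i * E i = E i := by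
    by_cases h : i = i₀
    · have : V * Vᴴ * (V * Vᴴ) = V * Vᴴ := by
        rw [Matrix.mul_assoc, ← Matrix.mul_assoc Vᴴ, hV, Matrix.one_mul]
      simp [E, h, Matrix.sub_mul, Matrix.mul_sub, this]
    · simp [E, h]
  have hEE' (i j : I) (h : i ≠ j) : E i * E j = 0 := by
    by_cases hi : i = i₀
    · simp [E, show j ≠ i₀ from fun hj => h (hi.trans hj.symm)]
    · simp [E, hi]
  have hmul (i j : I) : (V * D i * Vᴴ + E i) * (V * D j * Vᴴ + E j)
      = V * (D i * D j) * Vᴴ + E i * E j := by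
    have h1 : V * D i * Vᴴ * (V * D j * Vᴴ) = V * (D i * D j) * Vᴴ := by
      calc V * D i * Vᴴ * (V * D j * Vᴴ) = V * D i * (Vᴴ * V) * D j * Vᴴ := by
            simp only [Matrix.mul_assoc]
        _ = _ := by rw [hV, Matrix.mul_one]; simp only [Matrix.mul_assoc]
    have h2 : V * D i * Vᴴ * E j = 0 := by rw [Matrix.mul_assoc, hVE, Matrix.mul_zero]
    have h3 : E i * (V * D j * Vᴴ) = 0 := by rw [← Matrix.mul_assoc, ← Matrix.mul_assoc, hEV]; simp
    rw [Matrix.add_mul, Matrix.mul_add, Matrix.mul_add, h1, h2, h3, add_zero, zero_add]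
  refine ⟨⟨fun i => V * D i * Vᴴ + E i, fun i => ?_, fun i => ?_, fun i j h => ?_, ?_⟩,
    fun i => ?_⟩
  · simp [IsHermitian, conjTranspose_mul, hDH, hEH, Matrix.mul_assoc]
  · rw [hmul, hDD, hEE]
  · rw [hmul, hDD' i j h, hEE' i j h]; simp
  · have hD : ∑ i, D i = 1 := by
      ext a b
      simp [D, Matrix.sum_apply, single_apply, one_apply, ite_and]
    rw [Finset.sum_add_distrib, ← Matrix.sum_mul, ← Matrix.mul_sum, hD]
    simp [E]
  · have hQV : (V * D i * Vᴴ + E i) * V = V * D i := by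
      rw [Matrix.add_mul, hEV, Matrix.mul_assoc, hV]; simp
    rw [← toLpLin_mul_apply, ← mul_kronecker_mul, hQV, Matrix.mul_one,
      ← Matrix.one_mul (M.reject i), mul_kronecker_mul, toLpLin_mul_apply]
    have h0 : toLpLin 2 2 (D i ⊗ₖ M.reject i) M.purification = 0 := by
      ext ⟨j, b⟩
      rw [toLpLin_kronecker_apply, Finset.sum_eq_single i]
      · simp only [purification, mul_left_comm _ ((_ : ℝ) : ℂ), ← Finset.mul_sum,
          M.reject_mulVec_state]
        simp
      · intro k _ hk
        simp [D, hk.symm]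
      · simp
    rw [h0, map_zero]

theorem Measurement.sum_norm_sq_kronecker_one (Q : Measurement X I) (w : Vec (X × B)) :
    ∑ i, ‖toLpLin 2 2 (Q.proj i ⊗ₖ (1 : Matrix B B ℂ)) w‖ ^ 2 = ‖w‖ ^ 2 := by
  refine sum_norm_sq_toLpLin_projection (fun i => ?_) (fun i => ?_) ?_ w
  · rw [IsHermitian, conjTranspose_kronecker, conjTranspose_one, Q.hermitian i]
  · rw [← mul_kronecker_mul, one_mul, Q.idempotent]
  · rw [← one_kronecker_one, ← Q.complete]
    ext ⟨a, b⟩ ⟨a', b'⟩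
    simp [Matrix.sum_apply, Finset.sum_mul]

/-- A measurement that opens `φ` perfectly is detected on `w` at most as much as `w` differs
from a multiple of `φ`. -/
theorem sum_norm_sq_reject_le (M : Mixture B I) (Q : Measurement X I) {φ : Vec (X × B)}
    (hQ : ∀ i, toLpLin 2 2 (Q.proj i ⊗ₖ M.reject i) φ = 0) (w : Vec (X × B)) (z : ℂ) :
    ∑ i, ‖toLpLin 2 2 (Q.proj i ⊗ₖ M.reject i) w‖ ^ 2 ≤ ‖w - z • φ‖ ^ 2 := by
  have hsub (i : I) : toLpLin 2 2 (Q.proj i ⊗ₖ M.reject i) w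
      = toLpLin 2 2 ((1 : Matrix X X ℂ) ⊗ₖ M.reject i)
        (toLpLin 2 2 (Q.proj i ⊗ₖ (1 : Matrix B B ℂ)) (w - z • φ)) := by
    rw [← toLpLin_mul_apply, ← mul_kronecker_mul, one_mul, mul_one, map_sub, map_smul, hQ,
      smul_zero, sub_zero]
  have hle (i : I) : ‖toLpLin 2 2 (Q.proj i ⊗ₖ M.reject i) w‖ ^ 2
      ≤ ‖toLpLin 2 2 (Q.proj i ⊗ₖ (1 : Matrix B B ℂ)) (w - z • φ)‖ ^ 2 := by
    rw [hsub]
    refine pow_le_pow_left₀ (norm_nonneg _) (norm_toLpLin_projection_le ?_ ?_ _) 2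
    · rw [IsHermitian, conjTranspose_kronecker, conjTranspose_one, M.isHermitian_reject i]
    · rw [← mul_kronecker_mul, one_mul, M.reject_mul_self]
  exact (Finset.sum_le_sum fun i _ => hle i).trans_eq (Q.sum_norm_sq_kronecker_one _)

end Opening

/-! ### The controlled superposition and its rotated measurements -/

section Cheating

set_option linter.unusedSectionVars false

/-- The orthonormal basis of a qubit obtained from the computational one by a rotation. -/
def rotatedBasis (c s : ℝ) (k : Fin 2) : Fin 2 → ℝ := ![![c, s], ![-s, c]] k

/-- The measurement of a qubit in the rotated basis. -/
def rotatedMeasurement {c s : ℝ} (h : c ^ 2 + s ^ 2 = 1) : Measurement (Fin 2) (Fin 2) where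
  proj k := of fun a a' => ((rotatedBasis c s k a * rotatedBasis c s k a' : ℝ) : ℂ)
  hermitian k := by
    ext a a'
    simp [mul_comm]
  idempotent k := by
    ext a a'
    have h' : rotatedBasis c s k 0 * rotatedBasis c s k 0
        + rotatedBasis c s k 1 * rotatedBasis c s k 1 = 1 := by
      fin_cases k <;> simp [rotatedBasis] <;> linarith
    simp only [mul_apply, of_apply, Fin.sum_univ_two]
    norm_cast
    linear_combination (rotatedBasis c s k a * rotatedBasis c s k a') * h'
  orthogonal k l hkl := by
    ext a a'
    have h' : rotatedBasis c s k 0 * rotatedBasis c s l 0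
        + rotatedBasis c s k 1 * rotatedBasis c s l 1 = 0 := by
      fin_cases k <;> fin_cases l <;> simp [rotatedBasis] at hkl ⊢ <;> ring
    simp only [mul_apply, of_apply, Fin.sum_univ_two, Matrix.zero_apply]
    norm_cast
    linear_combination (rotatedBasis c s k a * rotatedBasis c s l a') * h'
  complete := by
    ext a a'
    simp only [Matrix.sum_apply, of_apply, Fin.sum_univ_two]
    fin_cases a <;> fin_cases a' <;> simp [rotatedBasis] <;> norm_cast <;> linarith

variable {B X : Type} {I : Fin 2 → Type} [Fintype B] [DecidableEq B] [Fintype X] [DecidableEq X]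
  [∀ b, Fintype (I b)]

theorem norm_toLpLin_kronecker_one_of_isometry {J : Type} [Fintype J] [DecidableEq J]
    {V : Matrix X J ℂ} (hV : Vᴴ * V = 1) (v : Vec (J × B)) :
    ‖toLpLin 2 2 (V ⊗ₖ (1 : Matrix B B ℂ)) v‖ = ‖v‖ := by
  refine norm_toLpLin_of_isometry ?_ v
  rw [conjTranspose_kronecker, ← mul_kronecker_mul, hV, conjTranspose_one, one_mul,
    one_kronecker_one]

/-- A measurement of a control qubit followed by a measurement depending on its outcome. -/
def Measurement.controlled (R : Measurement (Fin 2) (Fin 2)) (Q : ∀ b, Measurement X (I b)) :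
    Measurement (Fin 2 × X) (Claim I) where
  proj k := R.proj k.1 ⊗ₖ (Q k.1).proj k.2
  hermitian k := by
    rw [IsHermitian, conjTranspose_kronecker, R.hermitian, (Q k.1).hermitian]
  idempotent k := by rw [← mul_kronecker_mul, R.idempotent, (Q k.1).idempotent]
  orthogonal := by
    rintro ⟨b, i⟩ ⟨b', i'⟩ h
    rw [← mul_kronecker_mul]
    by_cases hb : b = b'
    · subst hb
      have hi : i ≠ i' := fun hi => h (by rw [hi])
      rw [(Q b).orthogonal _ _ hi, kronecker_zero]
    · rw [R.orthogonal _ _ hb, zero_kronecker]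
  complete := by
    have h (b : Fin 2) : ∑ i, R.proj b ⊗ₖ (Q b).proj i = R.proj b ⊗ₖ (1 : Matrix X X ℂ) := by
      rw [← (Q b).complete]
      ext ⟨a, x⟩ ⟨a', x'⟩
      simp [Matrix.sum_apply, Finset.mul_sum]
    rw [Fintype.sum_sigma]
    simp only [h]
    rw [← one_kronecker_one, ← R.complete]
    ext ⟨a, x⟩ ⟨a', x'⟩
    simp [Matrix.sum_apply, add_mul]

/-- The equal superposition of `φ 0` and `φ 1` controlled by a qubit. -/
def controlledState (φ : Fin 2 → Vec (X × B)) : Vec ((Fin 2 × X) × B) :=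
  WithLp.toLp 2 fun y => (√2 : ℂ)⁻¹ * φ y.1.1 (y.1.2, y.2)

theorem norm_inv_sqrt_two_sq : ‖(√2 : ℂ)⁻¹‖ ^ 2 = 1 / 2 := by
  rw [norm_inv, Complex.norm_of_nonneg (Real.sqrt_nonneg _), inv_pow, Real.sq_sqrt zero_le_two]
  norm_num

theorem norm_controlledState {φ : Fin 2 → Vec (X × B)} (hφ : ∀ b, ‖φ b‖ = 1) :
    ‖controlledState φ‖ = 1 := by
  refine (pow_left_inj₀ (norm_nonneg _) zero_le_one two_ne_zero).1 ?_
  have h (b : Fin 2) : ∑ x, ∑ y, ‖φ b (x, y)‖ ^ 2 = 1 := by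
    rw [← Fintype.sum_prod_type', ← EuclideanSpace.norm_sq_eq, hφ, one_pow]
  rw [EuclideanSpace.norm_sq_eq]
  simp only [Fintype.sum_prod_type, controlledState, norm_mul, mul_pow, norm_inv_sqrt_two_sq,
    ← Finset.mul_sum, h]
  simp

/-- The qubit projection has rank one, onto a real unit vector `u`, so the projected state is `u`
tensored with `(u₀φ₀ + u₁φ₁)/√2`. This removes the control qubit from all later computations. -/
theorem norm_sq_controlled_apply {c s : ℝ} (h : c ^ 2 + s ^ 2 = 1) (k : Fin 2)
    (Q : Matrix X X ℂ) (N : Matrix B B ℂ) (φ : Fin 2 → Vec (X × B)) :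
    ‖toLpLin 2 2 (((rotatedMeasurement h).proj k ⊗ₖ Q) ⊗ₖ N) (controlledState φ)‖ ^ 2 =
      ‖toLpLin 2 2 (Q ⊗ₖ N) ((rotatedBasis c s k 0 : ℂ) • φ 0
        + (rotatedBasis c s k 1 : ℂ) • φ 1)‖ ^ 2 / 2 := by
  set u := rotatedBasis c s k with hu
  set w := (u 0 : ℂ) • φ 0 + (u 1 : ℂ) • φ 1
  have hentry (a : Fin 2) (x : X) (b : B) :
      toLpLin 2 2 (((rotatedMeasurement h).proj k ⊗ₖ Q) ⊗ₖ N) (controlledState φ) ((a, x), b)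
        = (√2 : ℂ)⁻¹ * u a * toLpLin 2 2 (Q ⊗ₖ N) w (x, b) := by
    simp only [toLpLin_kronecker_apply, Fintype.sum_prod_type, Fin.sum_univ_two, kronecker_apply,
      rotatedMeasurement, of_apply, controlledState, w, PiLp.add_apply, PiLp.smul_apply,
      smul_eq_mul, ← hu, Complex.ofReal_mul, Finset.mul_sum, ← Finset.sum_add_distrib]
    refine Finset.sum_congr rfl fun x' _ => Finset.sum_congr rfl fun b' _ => ?_
    ring
  have hu1 : ‖(u 0 : ℂ)‖ ^ 2 + ‖(u 1 : ℂ)‖ ^ 2 = 1 := by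
    simp only [Complex.norm_real, Real.norm_eq_abs, sq_abs, hu]
    fin_cases k <;> simp [rotatedBasis] <;> linarith
  have hS : ‖toLpLin 2 2 (Q ⊗ₖ N) w‖ ^ 2 =
      ∑ x, ∑ b, ‖toLpLin 2 2 (Q ⊗ₖ N) w (x, b)‖ ^ 2 := by
    rw [EuclideanSpace.norm_sq_eq, Fintype.sum_prod_type]
  rw [EuclideanSpace.norm_sq_eq]
  simp only [Fintype.sum_prod_type, hentry, norm_mul, mul_pow, norm_inv_sqrt_two_sq,
    ← Finset.mul_sum, Fin.sum_univ_two, ← hS]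
  linear_combination (‖toLpLin 2 2 (Q ⊗ₖ N) w‖ ^ 2 / 2) * hu1

/-- The strategy that deposits a controlled superposition and, before opening, measures the
control qubit in a basis rotated one way for her zero strategy and the other way for her one
strategy. -/
def rotatedStrategy {c s : ℝ} (h : c ^ 2 + s ^ 2 = 1) (Q : ∀ b, Measurement X (I b))
    {φ : Fin 2 → Vec (X × B)} (hφ : ∀ b, ‖φ b‖ = 1) : Strategy (Fin 2 × X) B I where
  deposit := controlledState φ
  deposit_norm := norm_controlledState hφ
  -- Replacing `s` by `-s` flips the sign of the bias `2cs√f` and leaves the detection bound, which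
  -- depends on `s²`, unchanged.
  reveal := ![(rotatedMeasurement h).controlled Q,
    (rotatedMeasurement (c := c) (s := -s) (by rwa [neg_sq])).controlled Q]

theorem norm_sq_smul_add_smul {φ₀ φ₁ : Vec (X × B)} {g : ℝ} (h₀ : ‖φ₀‖ = 1) (h₁ : ‖φ₁‖ = 1)
    (hg : inner ℂ φ₀ φ₁ = (g : ℂ)) (x y : ℝ) :
    ‖(x : ℂ) • φ₀ + (y : ℂ) • φ₁‖ ^ 2 = x ^ 2 + 2 * x * y * g + y ^ 2 := by
  rw [norm_add_sq (𝕜 := ℂ), inner_smul_left, inner_smul_right, hg, norm_smul, norm_smul, h₀, h₁,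
    Complex.conj_ofReal, ← Complex.ofReal_mul, ← Complex.ofReal_mul]
  simp
  ring

/-- The claim and detection probabilities when `φ 0`, `φ 1` are measured through the control
qubit in a rotated basis. -/
theorem controlled_probabilities {c s : ℝ} (h : c ^ 2 + s ^ 2 = 1) (M : ∀ b, Mixture B (I b))
    (Q : ∀ b, Measurement X (I b)) {φ : Fin 2 → Vec (X × B)} (hφ : ∀ b, ‖φ b‖ = 1) {g : ℝ}
    (hg : inner ℂ (φ 0) (φ 1) = (g : ℂ))
    (hQ : ∀ b i, toLpLin 2 2 ((Q b).proj i ⊗ₖ (M b).reject i) (φ b) = 0)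
    {S : Strategy (Fin 2 × X) B I} (hS : S.deposit = controlledState φ) {t : Fin 2}
    (ht : S.reveal t = (rotatedMeasurement h).controlled Q) :
    S.claimProb t 0 = (1 + 2 * c * s * g) / 2 ∧ S.claimProb t 1 = (1 - 2 * c * s * g) / 2 ∧
      S.errProb M t ≤ s ^ 2 * (1 - g ^ 2) := by
  classical
  have hclaim (b : Fin 2) : S.claimProb t b = ‖(rotatedBasis c s b 0 : ℂ) • φ 0
        + (rotatedBasis c s b 1 : ℂ) • φ 1‖ ^ 2 / 2 := by
    simp only [Strategy.claimProb, hS, ht, Measurement.controlled, norm_sq_controlled_apply]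
    rw [← Finset.sum_div, (Q b).sum_norm_sq_kronecker_one]
  have herr : S.errProb M t = ∑ b, (∑ i, ‖toLpLin 2 2 ((Q b).proj i ⊗ₖ (M b).reject i)
      ((rotatedBasis c s b 0 : ℂ) • φ 0 + (rotatedBasis c s b 1 : ℂ) • φ 1)‖ ^ 2) / 2 := by
    simp only [Strategy.errProb, hS, ht, Measurement.controlled, norm_sq_controlled_apply,
      Fintype.sum_sigma, Finset.sum_div]
    rfl
  have hg' := norm_sq_smul_add_smul (hφ 0) (hφ 1) hg
  refine ⟨?_, ?_, ?_⟩
  · rw [hclaim, hg']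
    simp only [rotatedBasis, cons_val_zero, cons_val_one]
    linear_combination h / 2
  · rw [hclaim, hg']
    simp only [rotatedBasis, cons_val_zero, cons_val_one]
    linear_combination h / 2
  -- The scalars `c + sg` and `c - sg` are the inner products of `φ 0` and `φ 1` with the respective
  -- states, so each residual is orthogonal to the claimed vector and has squared norm `s²(1 - g²)`.
  -- Each of the two outcomes contributes half of that.
  · have h0 := sum_norm_sq_reject_le (M 0) (Q 0) (hQ 0)
      ((rotatedBasis c s 0 0 : ℂ) • φ 0 + (rotatedBasis c s 0 1 : ℂ) • φ 1) ((c + s * g : ℝ) : ℂ)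
    have h1 := sum_norm_sq_reject_le (M 1) (Q 1) (hQ 1)
      ((rotatedBasis c s 1 0 : ℂ) • φ 0 + (rotatedBasis c s 1 1 : ℂ) • φ 1) ((c - s * g : ℝ) : ℂ)
    have e0 : (rotatedBasis c s 0 0 : ℂ) • φ 0 + (rotatedBasis c s 0 1 : ℂ) • φ 1
        - ((c + s * g : ℝ) : ℂ) • φ 0 = ((-(s * g) : ℝ) : ℂ) • φ 0 + (s : ℂ) • φ 1 := by
      simp only [rotatedBasis, cons_val_zero, cons_val_one]
      push_cast
      module
    have e1 : (rotatedBasis c s 1 0 : ℂ) • φ 0 + (rotatedBasis c s 1 1 : ℂ) • φ 1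
        - ((c - s * g : ℝ) : ℂ) • φ 1 = ((-s : ℝ) : ℂ) • φ 0 + ((s * g : ℝ) : ℂ) • φ 1 := by
      simp only [rotatedBasis, cons_val_zero, cons_val_one]
      push_cast
      module
    rw [e0, hg'] at h0
    rw [e1, hg'] at h1
    rw [herr, Fin.sum_univ_two]
    linarith

end Cheating

/-! ### Choice of the rotation angle -/

/-- Halving the sine of the double angle at least halves the squared sine of the angle. -/
theorem exists_rotation_half_sin_two_mul {α : ℝ} (hα₀ : 0 ≤ α) (hα₁ : α ≤ Real.pi / 4) :
    ∃ c s : ℝ, c ^ 2 + s ^ 2 = 1 ∧ 2 * c * s = Real.sin (2 * α) / 2 ∧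
      s ^ 2 ≤ Real.sin α ^ 2 / 2 := by
  have hpi := Real.pi_pos
  have hC : 0 ≤ Real.cos (2 * α) := Real.cos_nonneg_of_mem_Icc ⟨by linarith, by linarith⟩
  have hS : 0 ≤ Real.sin (2 * α) := Real.sin_nonneg_of_mem_Icc ⟨by linarith, by linarith⟩
  have hS1 := Real.sin_le_one (2 * α)
  have hC1 := Real.cos_le_one (2 * α)
  set β := Real.arcsin (Real.sin (2 * α) / 2)
  have hβ : Real.sin β = Real.sin (2 * α) / 2 := Real.sin_arcsin (by linarith) (by linarith)
  have hcβ : 0 ≤ Real.cos β := Real.cos_arcsin_nonneg _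
  have h2 : 2 * (β / 2) = β := by ring
  -- With `C = cos 2α`, `cos²β = (3 + C²)/4` exceeds `(1 + C)²/4` by `(1 - C)/2 ≥ 0`. The half-angle
  -- formula turns this into the bound on `s²`.
  have hle : (1 + Real.cos (2 * α)) / 2 ≤ Real.cos β := by
    refine (abs_le_of_sq_le_sq' ?_ hcβ).2
    nlinarith [Real.sin_sq_add_cos_sq β, Real.sin_sq_add_cos_sq (2 * α)]
  refine ⟨Real.cos (β / 2), Real.sin (β / 2), Real.cos_sq_add_sin_sq _, ?_, ?_⟩
  · rw [← hβ, ← h2, Real.sin_two_mul, h2]; ring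
  · have h3 := Real.cos_two_mul (β / 2)
    have h4 := Real.cos_two_mul α
    rw [h2] at h3
    linarith [Real.sin_sq_add_cos_sq (β / 2), Real.sin_sq_add_cos_sq α]

end BitEscrow

end

theorem theorem8 {B : Type} {I : Fin 2 → Type} [Fintype B] [DecidableEq B]
    [∀ b, Fintype (I b)] (M : ∀ b, BitEscrow.Mixture B (I b))
    (f : ℝ) (hf : f = BitEscrow.fidelity (M 0).density (M 1).density)
    (α : ℝ) (hα₀ : 0 ≤ α) (hα₁ : α ≤ Real.pi / 4) :
    (∃ (A : Type) (_ : Fintype A) (_ : DecidableEq A) (S : BitEscrow.Strategy A B I),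
      S.claimProb 0 0 - S.claimProb 1 0 = √f * Real.sin (2 * α) / 2 ∧
      S.claimProb 1 1 - S.claimProb 0 1 = √f * Real.sin (2 * α) / 2 ∧
      S.errProb M 0 ≤ (1 - f) * Real.sin α ^ 2 / 2 ∧
      S.errProb M 1 ≤ (1 - f) * Real.sin α ^ 2 / 2) ∧
    ∀ γ : ℝ, γ < √f * Real.sin (2 * α) / 2 →
      ¬ BitEscrow.IsBinding M ((1 - f) * Real.sin α ^ 2 / 2) γ := by
  classical
  open BitEscrow in
  have key : ∃ (A : Type) (_ : Fintype A) (_ : DecidableEq A) (S : Strategy A B I),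
      S.claimProb 0 0 - S.claimProb 1 0 = √f * Real.sin (2 * α) / 2 ∧
      S.claimProb 1 1 - S.claimProb 0 1 = √f * Real.sin (2 * α) / 2 ∧
      S.errProb M 0 ≤ (1 - f) * Real.sin α ^ 2 / 2 ∧
      S.errProb M 1 ≤ (1 - f) * Real.sin α ^ 2 / 2 := by
    obtain ⟨V₀, V₁, hV₀, hV₁, hinner⟩ := exists_isometries_inner_eq_sqrt_fidelity (M 0) (M 1)
    rw [← hf] at hinner
    obtain ⟨Q₀, hQ₀⟩ := (M 0).exists_opening hV₀
    obtain ⟨Q₁, hQ₁⟩ := (M 1).exists_opening hV₁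
    obtain ⟨c, s, hcs, hsin, hs⟩ := exists_rotation_half_sin_two_mul hα₀ hα₁
    set φ₀ := Matrix.toLpLin 2 2 (V₀ ⊗ₖ (1 : Matrix B B ℂ)) (M 0).purification
    set φ₁ := Matrix.toLpLin 2 2 (V₁ ⊗ₖ (1 : Matrix B B ℂ)) (M 1).purification
    have hφ₀ : ‖φ₀‖ = 1 := by
      rw [norm_toLpLin_kronecker_one_of_isometry hV₀, Mixture.norm_purification]
    have hφ₁ : ‖φ₁‖ = 1 := by
      rw [norm_toLpLin_kronecker_one_of_isometry hV₁, Mixture.norm_purification]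
    have hf0 : 0 ≤ f := hf ▸ fidelity_nonneg _ _
    -- Cauchy–Schwarz for the optimal pair, whose overlap is `√f`.
    have hf1 : f ≤ 1 := by
      have h := norm_inner_le_norm (𝕜 := ℂ) φ₀ φ₁
      rw [hinner, hφ₀, hφ₁, Complex.norm_of_nonneg (Real.sqrt_nonneg _), mul_one] at h
      exact Real.sqrt_le_one.1 h
    let Q : ∀ b, Measurement (I 0 ⊕ I 1) (I b) := Fin.cons Q₀ (Fin.cons Q₁ finZeroElim)
    let φ : Fin 2 → Vec ((I 0 ⊕ I 1) × B) := ![φ₀, φ₁]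
    have hφ : ∀ b, ‖φ b‖ = 1 := Fin.forall_fin_two.2 ⟨hφ₀, hφ₁⟩
    have hQ : ∀ b i, Matrix.toLpLin 2 2 ((Q b).proj i ⊗ₖ (M b).reject i) (φ b) = 0 :=
      Fin.forall_fin_two.2 ⟨hQ₀, hQ₁⟩
    let S := rotatedStrategy hcs Q hφ
    obtain ⟨h00, h01, h0e⟩ := controlled_probabilities hcs M Q hφ hinner hQ
      (S := S) rfl (t := 0) rfl
    obtain ⟨h10, h11, h1e⟩ := controlled_probabilities (c := c) (s := -s) (by rwa [neg_sq]) M Q hφ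
      hinner hQ (S := S) rfl (t := 1) rfl
    have hbound : s ^ 2 * (1 - √f ^ 2) ≤ (1 - f) * Real.sin α ^ 2 / 2 := by
      rw [Real.sq_sqrt hf0]
      nlinarith [mul_le_mul_of_nonneg_left hs (sub_nonneg.2 hf1)]
    refine ⟨_, inferInstance, inferInstance, S, ?_, ?_, h0e.trans hbound,
      h1e.trans (by rwa [neg_sq])⟩
    -- The opposite biases `±cs√f` of the two strategies add up to `2cs√f`.
    · rw [h00, h10]; linear_combination √f * hsin
    · rw [h01, h11]; linear_combination √f * hsin
  refine ⟨key, fun γ hγ hbind => ?_⟩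
  obtain ⟨A, _, _, S, h0, -, he0, he1⟩ := key
  have h := (le_abs_self _).trans (hbind A S he0 he1).1
  linarith
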